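/- Let $\mathcal F$ be a free filter on $\mathbb N$, i.e. a family of subsets of $\mathbb N$ that does not contain $\emptyset$, contains all cofinite subsets of $\mathbb N$, and is closed under supersets and finite intersections. Identifying sets with their characteristic functions, view families of subsets of $\mathbb N$ as subspaces of the Cantor set $2^{\mathbb N}$. A space $X$ is *Menger* if for every sequence $(\mathcal U_n)_{n\in\mathbb N}$ of open covers of $X$ there are finite $\mathcal V_n\subseteq\mathcal U_n$ such that $\bigcup_n\mathcal V_n$ covers $X$. A space is *hereditarily Baire* if each of its closed subspaces is a Baire space. Let $K(\mathcal F)$ be the space of nonempty compact subsets of $\mathcal F$ with the Vietoris topology, and let $\mathcal F^+=\{A\subseteq\mathbb N:\mathbb N\setminus A\notin\mathcal F\}$. Then the following conditions are equivalent. 1. $\mathcal F$ is a strong $P$-filter: for every sequence $(\mathcal C_n)_{n\in\mathbb N}$ of compact subsets of $\mathcal F$ there are natural numbers $0=k_0<k_1<k_2<\cdots$ such that $\bigcup_{n\in\mathbb N}\bigl(X_n\cap[k_n,k_{n+1})\bigr)\in\mathcal F$ whenever $X_n\in\mathcal C_n$ for every $n$. 2. $\mathcal F$ is Menger at infinity: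 for some (equivalently, for every) Hausdorff compactification $b\mathcal F$ of $\mathcal F$, the remainder $b\mathcal F\setminus\mathcal F$ is Menger. 3. $K(\mathcal F)$ is hereditarily Baire. 4. $\mathcal F^+$ is Menger. -/

import Mathlib

open Set TopologicalSpace

universe u

/-- A topological space is Menger if for every sequence `U 0, U 1, …` of open covers there are
finite subfamilies `V n ⊆ U n` such that `⋃ n, V n` is a cover. -/
def IsMengerSpace (X : Type u) [TopologicalSpace X] : Prop :=
  ∀ U : ℕ → Set (Set X),
    (∀ n, (∀ W ∈ U n, IsOpen W) ∧ ⋃₀ U n = univ) →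
    ∃ V : ℕ → Set (Set X), (∀ n, V n ⊆ U n ∧ (V n).Finite) ∧ ⋃₀ (⋃ n, V n) = univ

/-- A topological space is hereditarily Baire if each of its closed subspaces is a Baire space. -/
def IsHereditarilyBaire (X : Type u) [TopologicalSpace X] : Prop :=
  ∀ S : Set X, IsClosed S → BaireSpace S

/-- `e : X → Z` exhibits `Z` as a (Hausdorff) compactification of `X`. -/
structure IsCompactification {X Z : Type u} [TopologicalSpace X] [TopologicalSpace Z]
    (e : X → Z) : Prop where
  compactSpace : CompactSpace Z
  t2Space : T2Space Z
  isDenseEmbedding : IsDenseEmbedding e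

/-- `X` is Menger at infinity: the remainder `Z \ X` of some compactification `Z` of `X` is Menger.
(Every compactification of `X : Type u` is homeomorphic to one in `Type u`, being a quotient of
the Stone–Čech compactification.) -/
def IsMengerAtInfinity (X : Type u) [TopologicalSpace X] : Prop :=
  ∃ (Z : Type u) (_ : TopologicalSpace Z) (e : X → Z),
    IsCompactification e ∧ IsMengerSpace ↥(range e)ᶜ

/-- The remainder `Z \ X` of every compactification `Z` of `X` is Menger. -/
def HasAllRemaindersMenger (X : Type u) [TopologicalSpace X] : Prop :=
  ∀ (Z : Type u) [TopologicalSpace Z] (e : X → Z),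
    IsCompactification e → IsMengerSpace ↥(range e)ᶜ

/-- The subset of `ℕ` whose characteristic function is the point `x` of the Cantor set. -/
def cantorSupport (x : ℕ → Bool) : Set ℕ := {n | x n = true}

/-- A family of subsets of `ℕ`, viewed as a subset of the Cantor set `2^ℕ` by identifying sets with
their characteristic functions. -/
def cantorSubset (A : Set (Set ℕ)) : Set (ℕ → Bool) := {x | cantorSupport x ∈ A}

/-- The dual ideal `F* = {A | ℕ \ A ∈ F}`. -/
def dualIdeal (F : Filter ℕ) : Set (Set ℕ) := {A | Aᶜ ∈ F}

/-- The family `F⁺ = P(ℕ) \ F*` of `F`-positive sets. -/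
def positiveSets (F : Filter ℕ) : Set (Set ℕ) := (dualIdeal F)ᶜ

/-- Strong `P`-filters: for every sequence of compact sets `C n ⊆ F` there are
`0 = k 0 < k 1 < …` such that `⋃ n, X n ∩ [k n, k (n + 1)) ∈ F` whenever `X n ∈ C n` for all `n`. -/
def IsStrongPFilter (F : Filter ℕ) : Prop :=
  ∀ C : ℕ → Set (ℕ → Bool),
    (∀ n, IsCompact (C n) ∧ C n ⊆ cantorSubset F.sets) →
    ∃ k : ℕ → ℕ, k 0 = 0 ∧ StrictMono k ∧
      ∀ X : ℕ → (ℕ → Bool), (∀ n, X n ∈ C n) →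
        (⋃ n, cantorSupport (X n) ∩ Ico (k n) (k (n + 1))) ∈ F

/-! Complementation carries `F⁺` onto the remainder of `F` in the Cantor set, and a Menger remainder
in one compactification gives a Menger remainder in all
(`IsCompactification.isMengerSpace_remainder`). This identifies conditions 2 and 4; a cycle through
1, 4 and 3 does the rest. A strong `P`-filter is applied to the compact sets of complements of
points missed by the covers; the resulting blocks yield finite subcovers. If the remainder is
Menger, the covering player of the Menger game has no winning strategy (`exists_play`). A Baire
category construction in a closed subspace of `K(F)` is run as such a strategy; when it is defeated,
the limit compact set lies inside `F`. Finally, gluing the `C n` along all finite sets of cut points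
gives countably many points of `K(F)`. If no infinite set of cuts works, they form a closed
countable subspace without isolated points, which cannot be Baire. -/

theorem exists_mem_Ico_of_strictMono {k : ℕ → ℕ} (h0 : k 0 = 0) (hk : StrictMono k) (m : ℕ) :
    ∃ n, k n ≤ m ∧ m < k (n + 1) := by
  have hex : ∃ n, m < k (n + 1) := ⟨m, lt_of_lt_of_le (Nat.lt_succ_self m) (hk.id_le (m + 1))⟩
  refine ⟨Nat.find hex, ?_, Nat.find_spec hex⟩
  rcases hn : Nat.find hex with _ | n
  · simp [h0]
  · exact not_lt.1 (Nat.find_min hex (m := n) (by omega))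

/-! ### Selection principles, the Menger game and preservation of the Menger property. -/

namespace IsMengerSpace

variable {X Y : Type*} [TopologicalSpace X] [TopologicalSpace Y]

theorem exists_forall_mem (hX : IsMengerSpace X) (U : ℕ → ℕ → Set X)
    (hopen : ∀ n k, IsOpen (U n k)) (hmono : ∀ n, Monotone (U n))
    (hcover : ∀ n x, ∃ k, x ∈ U n k) : ∃ f : ℕ → ℕ, ∀ x, ∃ n, x ∈ U n (f n) := by
  obtain ⟨V, hV, hVc⟩ := hX (fun n => range (U n)) fun n =>
    ⟨by rintro _ ⟨k, rfl⟩; exact hopen n k,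
      eq_univ_of_forall fun x => by
        obtain ⟨k, hk⟩ := hcover n x
        exact ⟨_, ⟨k, rfl⟩, hk⟩⟩
  have hbound : ∀ n, ∃ k, ∀ W ∈ V n, W ⊆ U n k := by
    intro n
    choose! g hg using fun W (hW : W ∈ V n) => (hV n).1 hW
    obtain ⟨k, hk⟩ := ((hV n).2.image g).bddAbove
    refine ⟨k, fun W hW => ?_⟩
    rw [← hg W hW]
    exact hmono n (hk ⟨W, hW, rfl⟩)
  choose f hf using hbound
  refine ⟨f, fun x => ?_⟩
  obtain ⟨W, hW, hxW⟩ := hVc.ge (mem_univ x)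
  obtain ⟨n, hn⟩ := mem_iUnion.1 hW
  exact ⟨n, hf n W hn hxW⟩

/-- A diagonal selection principle: one sequence `k` governs both the choice of the covers and the
choice of their members. -/
theorem exists_strictMono (hX : IsMengerSpace X) (W : ℕ → ℕ → Set X)
    (hopen : ∀ m k, IsOpen (W m k)) (hanti : ∀ k, Antitone fun m => W m k)
    (hmono : ∀ m, Monotone (W m)) (hcover : ∀ m x, ∃ k, x ∈ W m k) :
    ∃ k : ℕ → ℕ, k 0 = 0 ∧ StrictMono k ∧ ∀ x, ∃ n, x ∈ W (k n) (k (n + 1)) := by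
  -- The intermediate index `j` handles the grid: for `m` in `[k n, k (n + 1))`, the factor `W m j`
  -- serves if `j ≤ k (n + 1)`, and otherwise `W j (f m)` serves one block later.
  obtain ⟨f, hf⟩ := hX.exists_forall_mem (fun m k => ⋃ j, W m j ∩ W j k)
    (fun m k => isOpen_iUnion fun j => (hopen m j).inter (hopen j k))
    (fun m k k' h => iUnion_mono fun j => inter_subset_inter_right _ (hmono j h))
    (fun m x => by
      obtain ⟨j, hj⟩ := hcover m x
      obtain ⟨k, hk⟩ := hcover j x
      exact ⟨k, mem_iUnion.2 ⟨j, hj, hk⟩⟩)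
  let g : ℕ → ℕ := fun m => m + 1 + ∑ i ∈ Finset.range (m + 1), f i
  have hg : Monotone g := fun m m' h => by
    have : ∑ i ∈ Finset.range (m + 1), f i ≤ ∑ i ∈ Finset.range (m' + 1), f i :=
      Finset.sum_le_sum_of_subset (Finset.range_mono (by omega))
    simp only [g]
    omega
  have hfg : ∀ m, f m ≤ g m := fun m => by
    have : f m ≤ ∑ i ∈ Finset.range (m + 1), f i :=
      Finset.single_le_sum (fun _ _ => Nat.zero_le _) (Finset.self_mem_range_succ m)
    simp only [g]
    omega
  let k : ℕ → ℕ := fun n => g^[n] 0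
  have hk : ∀ n, k (n + 1) = g (k n) := fun n => Function.iterate_succ_apply' g n 0
  have hkm : StrictMono k := strictMono_nat_of_lt_succ fun n => by
    rw [hk]
    simp only [g]
    omega
  refine ⟨k, rfl, hkm, fun x => ?_⟩
  obtain ⟨m, hm⟩ := hf x
  obtain ⟨j, hmj, hjf⟩ := mem_iUnion.1 hm
  obtain ⟨n, hn, hn'⟩ := exists_mem_Ico_of_strictMono (k := k) rfl hkm m
  rcases le_total j (k (n + 1)) with h | h
  · exact ⟨n, hanti _ hn (hmono _ h hmj)⟩
  · refine ⟨n + 1, hanti _ h (hmono _ ?_ hjf)⟩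
    rw [hk]
    exact (hfg m).trans (hg hn'.le)

/-- The states reachable from `s₀` in at most `n` moves, each of which is at most `m`. -/
def reachable {σ : Type*} (s₀ : σ) (step : σ → ℕ → σ) (m : ℕ) : ℕ → Set σ
  | 0 => {s₀}
  | n + 1 => reachable s₀ step m n ∪ image2 step (reachable s₀ step m n) (Iic m)

section reachable

variable {σ : Type*} {s₀ : σ} {step : σ → ℕ → σ}

theorem reachable_finite (m n : ℕ) : (reachable s₀ step m n).Finite := by
  induction n with
  | zero => exact finite_singleton _
  | succ n ih => exact ih.union (ih.image2 _ (finite_Iic m))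

theorem reachable_mono {m m' n n' : ℕ} (hm : m ≤ m') (hn : n ≤ n') :
    reachable s₀ step m n ⊆ reachable s₀ step m' n' := by
  have h1 : reachable s₀ step m n ⊆ reachable s₀ step m' n := by
    clear hn
    induction n with
    | zero => exact Subset.rfl
    | succ n ih => exact union_subset_union ih (image2_subset ih (Iic_subset_Iic.2 hm))
  exact h1.trans (monotone_nat_of_le_succ (f := reachable s₀ step m')
    (fun n => subset_union_left) hn)

end reachable

/-- In a Menger space the covering player of the Menger game can be defeated: here `s n` is the
position after `n` rounds, `U (s n)` the cover offered and `g n` the reply. -/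
theorem exists_play (hX : IsMengerSpace X) {σ : Type*} (s₀ : σ) (step : σ → ℕ → σ)
    (U : σ → ℕ → Set X) (hopen : ∀ s k, IsOpen (U s k)) (hmono : ∀ s, Monotone (U s))
    (hcover : ∀ s x, ∃ k, x ∈ U s k) :
    ∃ (s : ℕ → σ) (g : ℕ → ℕ), s 0 = s₀ ∧ (∀ n, s (n + 1) = step (s n) (g n)) ∧
      ∀ x, ∃ n, x ∈ U (s n) (g n) := by
  obtain ⟨k, -, hk, hkx⟩ := hX.exists_strictMono
    -- Finitely many positions are reachable with bounded replies, so one cover refines all of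
    -- theirs. The actual position `s n` is among those for `m = k n`, as `n ≤ k n` and all earlier
    -- replies are at most `k n`.
    (fun m k => ⋂ s ∈ reachable s₀ step m m, U s k)
    (fun m k => (reachable_finite m m).isOpen_biInter fun s _ => hopen s k)
    (fun k m m' h => biInter_subset_biInter_left (reachable_mono h h))
    (fun m k k' h => iInter₂_mono fun s _ => hmono s h)
    (fun m x => by
      choose c hc using fun s => hcover s x
      obtain ⟨b, hb⟩ := ((reachable_finite (s₀ := s₀) (step := step) m m).image c).bddAbove
      exact ⟨b, mem_iInter₂.2 fun s hs => hmono s (hb ⟨s, hs, rfl⟩) (hc s)⟩)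
  let s : ℕ → σ := fun n => Nat.rec s₀ (fun n t => step t (k (n + 1))) n
  have hs : ∀ n, s n ∈ reachable s₀ step (k n) n := by
    intro n
    induction n with
    | zero => exact mem_singleton _
    | succ n ih =>
      exact Or.inr ⟨s n, reachable_mono (hk.monotone n.le_succ) le_rfl ih, k (n + 1),
        mem_Iic.2 le_rfl, rfl⟩
  refine ⟨s, fun n => k (n + 1), rfl, fun n => rfl, fun x => ?_⟩
  obtain ⟨n, hn⟩ := hkx x
  exact ⟨n, mem_iInter₂.1 hn _ (reachable_mono le_rfl (hk.id_le n) (hs n))⟩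

theorem of_surjective (hX : IsMengerSpace X) {f : X → Y} (hf : Continuous f)
    (hsurj : Function.Surjective f) : IsMengerSpace Y := by
  intro U hU
  obtain ⟨V, hV, hVc⟩ := hX (fun n => preimage f '' U n) fun n =>
    ⟨by rintro _ ⟨W, hW, rfl⟩; exact ((hU n).1 W hW).preimage hf,
      eq_univ_of_forall fun x => by
        obtain ⟨W, hW, hxW⟩ := (hU n).2.ge (mem_univ (f x))
        exact ⟨_, ⟨W, hW, rfl⟩, hxW⟩⟩
  choose V' hV' using fun n => exists_subset_image_finite_and.1 ⟨V n, (hV n).1, (hV n).2, rfl⟩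
  refine ⟨V', fun n => ⟨(hV' n).1, (hV' n).2.1⟩, eq_univ_of_forall fun y => ?_⟩
  obtain ⟨x, rfl⟩ := hsurj y
  obtain ⟨W, hW, hxW⟩ := hVc.ge (mem_univ x)
  obtain ⟨n, hn⟩ := mem_iUnion.1 hW
  rw [(hV' n).2.2] at hn
  obtain ⟨W', hW', rfl⟩ := hn
  exact ⟨W', mem_iUnion.2 ⟨n, hW'⟩, hxW⟩

/-- Fibres are compact and `f` is closed, so the open sets whose preimage is finitely covered by `U
n` cover `Y`. -/
theorem of_isProperMap (hY : IsMengerSpace Y) {f : X → Y} (hf : IsProperMap f) :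
    IsMengerSpace X := by
  intro U hU
  obtain ⟨V, hV, hVc⟩ := hY
    (fun n => {N | IsOpen N ∧ ∃ T ⊆ U n, T.Finite ∧ f ⁻¹' N ⊆ ⋃₀ T}) fun n =>
    ⟨fun N hN => hN.1, eq_univ_of_forall fun y => by
      have hc : IsCompact (f ⁻¹' {y}) := hf.isCompact_preimage isCompact_singleton
      obtain ⟨T, hTU, hT, hsub⟩ := hc.elim_finite_subcover_image (b := U n) (c := id)
        (fun W hW => (hU n).1 W hW) fun x _ => by
          obtain ⟨W, hW, hxW⟩ := (hU n).2.ge (mem_univ x)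
          exact mem_biUnion hW hxW
      have hTo : IsOpen (⋃₀ T) := isOpen_sUnion fun W hW => (hU n).1 W (hTU hW)
      refine ⟨(f '' (⋃₀ T)ᶜ)ᶜ, ⟨(hf.isClosedMap _ hTo.isClosed_compl).isOpen_compl,
        T, hTU, hT, fun x hx => ?_⟩, ?_⟩
      · by_contra h
        exact hx ⟨x, h, rfl⟩
      · rintro ⟨x, hx, rfl⟩
        rw [sUnion_eq_biUnion] at hx
        exact hx (hsub rfl)⟩
  choose T hTU hT hsub using fun n (N : V n) => ((hV n).1 N.2).2
  refine ⟨fun n => ⋃ N, T n N, fun n => ⟨iUnion_subset fun N => hTU n N, ?_⟩,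
    eq_univ_of_forall fun x => ?_⟩
  · have := (hV n).2.to_subtype
    exact finite_iUnion fun N => hT n N
  · obtain ⟨N, hN, hxN⟩ := hVc.ge (mem_univ (f x))
    obtain ⟨n, hn⟩ := mem_iUnion.1 hN
    obtain ⟨W, hW, hxW⟩ := hsub n ⟨N, hn⟩ hxN
    exact ⟨W, mem_iUnion.2 ⟨n, mem_iUnion.2 ⟨_, hW⟩⟩, hxW⟩

end IsMengerSpace

/-! ### Independence of the compactification. -/

open Filter Topology in
/-- A point of the closure of the graph of `e₂ ∘ e₁⁻¹` over a point of the range of `e₁` belongs to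
the graph. -/
theorem eq_of_mem_closure_range_prodMk {X Z₁ Z₂ : Type*} [TopologicalSpace X] [TopologicalSpace Z₁]
    [TopologicalSpace Z₂] [T2Space Z₂] {e₁ : X → Z₁} {e₂ : X → Z₂} (h₁ : IsInducing e₁)
    (h₂ : Continuous e₂) {z : Z₁ × Z₂} (hz : z ∈ closure (range fun x => (e₁ x, e₂ x))) {x : X}
    (hx : z.1 = e₁ x) : z.2 = e₂ x := by
  have : (comap (fun x => (e₁ x, e₂ x)) (𝓝 z)).NeBot := by
    refine comap_neBot fun t ht => ?_
    obtain ⟨_, hy, ⟨y, rfl⟩⟩ := mem_closure_iff_nhds.1 hz t ht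
    exact ⟨y, hy⟩
  have ht : Tendsto (fun x => (e₁ x, e₂ x)) (comap (fun x => (e₁ x, e₂ x)) (𝓝 z)) (𝓝 z) :=
    tendsto_comap
  have h1 : Tendsto e₁ (comap (fun x => (e₁ x, e₂ x)) (𝓝 z)) (𝓝 (e₁ x)) :=
    hx ▸ (continuous_fst.tendsto z).comp ht
  have h2 : Tendsto id (comap (fun x => (e₁ x, e₂ x)) (𝓝 z)) (𝓝 x) := h₁.tendsto_nhds_iff.2 h1
  exact tendsto_nhds_unique ((continuous_snd.tendsto z).comp ht) ((h₂.tendsto x).comp h2)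

/-- The Menger property of the remainder does not depend on the compactification. -/
theorem IsCompactification.isMengerSpace_remainder {X Z₁ Z₂ : Type u} [TopologicalSpace X]
    [TopologicalSpace Z₁] [TopologicalSpace Z₂] {e₁ : X → Z₁} {e₂ : X → Z₂}
    (h₁ : IsCompactification e₁) (h₂ : IsCompactification e₂)
    (hM : IsMengerSpace ↥(range e₁)ᶜ) : IsMengerSpace ↥(range e₂)ᶜ := by
  have := h₁.compactSpace
  have := h₁.t2Space
  have := h₂.compactSpace
  have := h₂.t2Space
  have hc₁ := h₁.isDenseEmbedding.isDenseInducing.continuous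
  have hc₂ := h₂.isDenseEmbedding.isDenseInducing.continuous
  -- Over the ranges, the closed graph `G` contains only the graph, so a point of `G` has its first
  -- coordinate in the remainder exactly when its second is. The Menger property pulls back along
  -- the proper first projection and pushes forward along the second.
  let G : Set (Z₁ × Z₂) := closure (range fun x => (e₁ x, e₂ x))
  have hG : IsClosed G := isClosed_closure
  have : CompactSpace G := isCompact_iff_compactSpace.1 hG.isCompact
  let p : G → Z₁ := fun z => z.1.1
  have hp : IsProperMap p := Continuous.isProperMap (by fun_prop)
  have hA := hM.of_isProperMap (hp.restrictPreimage (range e₁)ᶜ)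
  let q : p ⁻¹' (range e₁)ᶜ → ↥(range e₂)ᶜ := fun z => ⟨z.1.1.2, by
    rintro ⟨x, hx⟩
    have hz : Prod.swap z.1.1 ∈ closure (range fun x => (e₂ x, e₁ x)) := by
      refine map_mem_closure continuous_swap z.1.2 ?_
      rintro _ ⟨y, rfl⟩
      exact ⟨y, rfl⟩
    exact z.2 ⟨x, (eq_of_mem_closure_range_prodMk
      h₂.isDenseEmbedding.isDenseInducing.isInducing hc₁ hz hx.symm).symm⟩⟩
  refine hA.of_surjective (f := q) (by fun_prop) ?_
  rintro ⟨w, hw⟩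
  have himg : IsClosed (Prod.snd '' G) := (hG.isCompact.image continuous_snd).isClosed
  have hsub : range e₂ ⊆ Prod.snd '' G := by
    rintro _ ⟨x, rfl⟩
    exact ⟨_, subset_closure ⟨x, rfl⟩, rfl⟩
  obtain ⟨z, hz, rfl⟩ := himg.closure_subset_iff.2 hsub (h₂.isDenseEmbedding.dense w)
  refine ⟨⟨⟨z, hz⟩, ?_⟩, rfl⟩
  rintro ⟨x, hx⟩
  exact hw ⟨x, (eq_of_mem_closure_range_prodMk
    h₁.isDenseEmbedding.isDenseInducing.isInducing hc₂ hz hx.symm).symm⟩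

/-! ### The Cantor set and its closed sets through initial segments. -/

/-- The restriction of a point of the Cantor set to its first `n` coordinates. -/
def trunc (n : ℕ) (x : ℕ → Bool) : Fin n → Bool := fun i => x i

theorem trunc_eq_trunc_iff {n : ℕ} {x y : ℕ → Bool} :
    trunc n x = trunc n y ↔ ∀ i < n, x i = y i := by
  simp only [funext_iff, trunc, Fin.forall_iff]

theorem continuous_trunc (n : ℕ) : Continuous (trunc n) :=
  continuous_pi fun i => continuous_apply (i : ℕ)

theorem isClopen_preimage_trunc {n : ℕ} (s : Set (Fin n → Bool)) : IsClopen (trunc n ⁻¹' s) :=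
  (isClopen_discrete s).preimage (continuous_trunc n)

theorem isClopen_of_trunc {n : ℕ} {D : Set (ℕ → Bool)}
    (h : ∀ x y, trunc n x = trunc n y → x ∈ D → y ∈ D) : IsClopen D := by
  convert isClopen_preimage_trunc (trunc n '' D)
  refine (subset_preimage_image _ _).antisymm ?_
  rintro y ⟨x, hx, hxy⟩
  exact h x y hxy hx

theorem exists_trunc_of_isOpen {U : Set (ℕ → Bool)} (hU : IsOpen U) {x : ℕ → Bool} (hx : x ∈ U) :
    ∃ n, ∀ y, trunc n y = trunc n x → y ∈ U := by
  obtain ⟨I, u, hu, hsub⟩ := isOpen_pi_iff.1 hU x hx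
  refine ⟨I.sup id + 1, fun y hy => hsub fun i hi => ?_⟩
  rw [trunc_eq_trunc_iff.1 hy i (Nat.lt_succ_of_le (Finset.le_sup (f := id) hi))]
  exact (hu i hi).2

theorem trunc_image_eq_of_le {n m : ℕ} (h : n ≤ m) {A B : Set (ℕ → Bool)}
    (hAB : trunc m '' A = trunc m '' B) : trunc n '' A = trunc n '' B := by
  have : trunc n = (fun t i => t (Fin.castLE h i)) ∘ trunc m := rfl
  rw [this, image_comp, image_comp, hAB]

theorem subset_of_trunc_image_subset {A B : Set (ℕ → Bool)} (hB : IsClosed B)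
    (h : ∀ n, trunc n '' A ⊆ trunc n '' B) : A ⊆ B := by
  intro x hx
  by_contra hxB
  obtain ⟨n, hn⟩ := exists_trunc_of_isOpen hB.isOpen_compl hxB
  obtain ⟨y, hy, hyx⟩ := h n ⟨x, hx, rfl⟩
  exact hn y hyx hy

theorem eq_of_trunc_image_eq {A B : Set (ℕ → Bool)} (hA : IsClosed A) (hB : IsClosed B)
    (h : ∀ n, trunc n '' A = trunc n '' B) : A = B :=
  (subset_of_trunc_image_subset hB fun n => (h n).le).antisymm
    (subset_of_trunc_image_subset hA fun n => (h n).ge)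

/-! ### From strong `P`-filters to Menger families of positive sets. -/

theorem mem_cantorSubset_positiveSets {F : Filter ℕ} {x : ℕ → Bool} :
    x ∈ cantorSubset (positiveSets F) ↔ (cantorSupport x)ᶜ ∉ F := Iff.rfl

theorem continuous_not_comp : Continuous fun (x : ℕ → Bool) i => !x i :=
  continuous_pi fun i => (continuous_of_discreteTopology (f := not)).comp (continuous_apply i)

theorem cantorSupport_not (x : ℕ → Bool) :
    cantorSupport (fun i => !x i) = (cantorSupport x)ᶜ := by
  ext i
  simp [cantorSupport]

theorem IsStrongPFilter.isMengerSpace {F : Filter ℕ} (hF : IsStrongPFilter F) :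
    IsMengerSpace ↥(cantorSubset (positiveSets F)) := by
  intro U hU
  let 𝒪 : ℕ → Set (Set (ℕ → Bool)) := fun n => {W | IsOpen W ∧ Subtype.val ⁻¹' W ∈ U n}
  have h𝒪 : ∀ n, IsOpen (⋃₀ 𝒪 n) := fun n => isOpen_sUnion fun W hW => hW.1
  have hcov : ∀ n x, x ∈ cantorSubset (positiveSets F) → x ∈ ⋃₀ 𝒪 n := by
    intro n x hx
    obtain ⟨W, hW, hxW⟩ := (hU n).2.ge (mem_univ ⟨x, hx⟩)
    obtain ⟨W', hW', rfl⟩ := isOpen_induced_iff.1 ((hU n).1 W hW)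
    exact ⟨W', ⟨hW', hW⟩, hxW⟩
  obtain ⟨k, -, hk, hkF⟩ := hF (fun n => (fun x i => !x i) ⁻¹' (⋃₀ 𝒪 n)ᶜ) fun n =>
    ⟨((h𝒪 n).isClosed_compl.preimage continuous_not_comp).isCompact, fun x hx => by
      by_contra hxF
      refine hx (hcov n _ ?_)
      rw [mem_cantorSubset_positiveSets, cantorSupport_not, compl_compl]
      exact hxF⟩
  let Up : ℕ → (ℕ → Bool) → Set (ℕ → Bool) := fun n a =>
    {b | ∀ i ∈ Ico (k n) (k (n + 1)), a i = true → b i = true}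
  -- Membership depends only on coordinates below `k (n + 1)`; compactness then extracts a finite
  -- part of `𝒪 n`.
  have hD : ∀ n, IsClopen {a | Up n a ⊆ ⋃₀ 𝒪 n} := fun n =>
    isClopen_of_trunc (n := k (n + 1)) fun x y hxy hx b hb => hx fun i hi hxi =>
      hb i hi (trunc_eq_trunc_iff.1 hxy i hi.2 ▸ hxi)
  have hsub : ∀ n, {a | Up n a ⊆ ⋃₀ 𝒪 n} ⊆ ⋃ W ∈ 𝒪 n, id W := fun n a ha => by
    obtain ⟨W, hW, haW⟩ := ha (fun _ _ h => h : a ∈ Up n a)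
    exact mem_biUnion hW haW
  choose T hTO hT hTc using fun n => (hD n).isClosed.isCompact.elim_finite_subcover_image
    (fun W (hW : W ∈ 𝒪 n) => hW.1) (hsub n)
  refine ⟨fun n => preimage Subtype.val '' T n, fun n => ⟨?_, (hT n).image _⟩,
    eq_univ_of_forall fun a => ?_⟩
  · rintro _ ⟨W, hW, rfl⟩
    exact (hTO n hW).2
  -- Otherwise each block has a missed `b n` containing `a` there; gluing the complements of the `b
  -- n` gives a member of `F` disjoint from `a`, against positivity.
  · obtain ⟨n, hn⟩ : ∃ n, Up n a ⊆ ⋃₀ 𝒪 n := by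
      by_contra! h
      choose b hb hbO using fun n => not_subset.1 (h n)
      refine a.2 (Filter.mem_of_superset (hkF (fun n i => !b n i) fun n => ?_) ?_)
      · simpa using hbO n
      · refine iUnion_subset fun n i hi hai => ?_
        have h1 : (!b n i) = true := hi.1
        rw [hb n i hi.2 hai] at h1
        exact absurd h1 (by simp)
    obtain ⟨W, hW, haW⟩ := mem_iUnion₂.1 (hTc n hn)
    exact ⟨_, mem_iUnion.2 ⟨n, W, hW, rfl⟩, haW⟩

/-! ### The Vietoris topology in terms of traces on initial segments. -/

namespace TopologicalSpace.NonemptyCompacts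

variable {X : Set (ℕ → Bool)}

/-- A compact subset of a subspace `X` of the Cantor set, as a subset of the Cantor set. -/
def ambient (K : NonemptyCompacts X) : Set (ℕ → Bool) := Subtype.val '' (K : Set X)

theorem isCompact_ambient (K : NonemptyCompacts X) : IsCompact K.ambient :=
  K.isCompact.image continuous_subtype_val

theorem ambient_subset (K : NonemptyCompacts X) : K.ambient ⊆ X := by
  rintro _ ⟨x, -, rfl⟩
  exact x.2

theorem ambient_injective : Function.Injective (ambient : NonemptyCompacts X → _) := fun _ _ h =>
  SetLike.coe_injective (Subtype.val_injective.image_injective h)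

theorem exists_ambient_eq {A : Set (ℕ → Bool)} (hA : IsCompact A) (hne : A.Nonempty) (hX : A ⊆ X) :
    ∃ K : NonemptyCompacts X, K.ambient = A := by
  have hrange : A ⊆ range (Subtype.val : X → ℕ → Bool) := by rwa [Subtype.range_val]
  have himg : Subtype.val '' (Subtype.val ⁻¹' A : Set X) = A := image_preimage_eq_of_subset hrange
  refine ⟨⟨⟨Subtype.val ⁻¹' A, ?_⟩, ?_⟩, himg⟩
  · rwa [Topology.IsInducing.subtypeVal.isCompact_iff, himg]
  · exact image_nonempty.1 (himg.symm ▸ hne)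

theorem isClopen_setOf_trunc_image_ambient (n : ℕ) (T : Set (Fin n → Bool)) :
    IsClopen {K : NonemptyCompacts X | trunc n '' K.ambient = T} := by
  have hf : Continuous fun x : X => trunc n x := (continuous_trunc n).comp continuous_subtype_val
  have : {K : NonemptyCompacts X | trunc n '' K.ambient = T} =
      NonemptyCompacts.map _ hf ⁻¹' {L | (L : Set (Fin n → Bool)) = T} := by
    ext K
    simp [ambient, image_image]
  rw [this]
  exact (isClopen_discrete _).preimage hf.nonemptyCompacts_map

theorem exists_trunc_of_coe_subset {U : Set X} (hU : IsOpen U) {K : NonemptyCompacts X}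
    (hK : (K : Set X) ⊆ U) : ∃ n, ∀ L : NonemptyCompacts X,
      trunc n '' L.ambient = trunc n '' K.ambient → (L : Set X) ⊆ U := by
  obtain ⟨V, hV, rfl⟩ := isOpen_induced_iff.1 hU
  have hsub : K.ambient ⊆ ⋃ n, {x | ∀ y, trunc n y = trunc n x → y ∈ V} := by
    rintro _ ⟨x, hx, rfl⟩
    exact mem_iUnion.2 (exists_trunc_of_isOpen hV (hK hx))
  obtain ⟨n, hn⟩ := K.isCompact_ambient.elim_directed_cover
    (fun n => {x : ℕ → Bool | ∀ y, trunc n y = trunc n x → y ∈ V})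
    (fun n => (isClopen_of_trunc (n := n) (D := {x | ∀ y, trunc n y = trunc n x → y ∈ V})
      fun x y hxy hx z hz => hx z (hz.trans hxy.symm)).isOpen)
    hsub (Monotone.directed_le fun n m h x hx y hy => hx y (trunc_eq_trunc_iff.2 fun i hi =>
      trunc_eq_trunc_iff.1 hy i (hi.trans_le h)))
  refine ⟨n, fun L hL x hx => ?_⟩
  obtain ⟨y, hy, hyx⟩ := hL.le ⟨x, ⟨x, hx, rfl⟩, rfl⟩
  exact hn hy x hyx.symm

theorem exists_trunc_of_inter_nonempty {U : Set X} (hU : IsOpen U) {K : NonemptyCompacts X}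
    (hK : ((K : Set X) ∩ U).Nonempty) : ∃ n, ∀ L : NonemptyCompacts X,
      trunc n '' L.ambient = trunc n '' K.ambient → ((L : Set X) ∩ U).Nonempty := by
  obtain ⟨V, hV, rfl⟩ := isOpen_induced_iff.1 hU
  obtain ⟨x, hx, hxV⟩ := hK
  obtain ⟨n, hn⟩ := exists_trunc_of_isOpen hV hxV
  refine ⟨n, fun L hL => ?_⟩
  obtain ⟨_, ⟨y, hy, rfl⟩, hyx⟩ := hL.ge ⟨x, ⟨x, hx, rfl⟩, rfl⟩
  exact ⟨y, hy, hn y hyx⟩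

/-- The sets of all `L` with the same traces as `K` on the first `n` coordinates form a
neighbourhood basis of `K` in the Vietoris topology. -/
theorem exists_trunc_of_mem_isOpen {W : Set (NonemptyCompacts X)} (hW : IsOpen W)
    {K : NonemptyCompacts X} (hK : K ∈ W) : ∃ n, ∀ L : NonemptyCompacts X,
      trunc n '' L.ambient = trunc n '' K.ambient → L ∈ W := by
  obtain ⟨_, ⟨u, ⟨hu, -, huo⟩, rfl⟩, ⟨hKu, hKU⟩, hsub⟩ :=
    isTopologicalBasis.exists_subset_of_mem_open hK hW
  obtain ⟨n₀, hn₀⟩ := exists_trunc_of_coe_subset (isOpen_sUnion huo) hKu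
  choose! c hc using fun U (hU : U ∈ u) => exists_trunc_of_inter_nonempty (huo U hU) (hKU U hU)
  obtain ⟨b, hb⟩ := (hu.image c).bddAbove
  refine ⟨max n₀ b, fun L hL => hsub ⟨hn₀ L (trunc_image_eq_of_le (le_max_left _ _) hL),
    fun U hU => hc U hU L (trunc_image_eq_of_le ?_ hL)⟩⟩
  exact (hb ⟨U, hU, rfl⟩).trans (le_max_right _ _)

end TopologicalSpace.NonemptyCompacts

/-! ### From a Menger complement to hereditarily Baire hyperspaces. -/

/-- Sets whose traces on longer and longer initial segments cohere have a limit. -/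
theorem exists_isClosed_trunc_image_eq (A : ℕ → Set (ℕ → Bool)) {M : ℕ → ℕ} (hM : Monotone M)
    (hA : ∀ n, trunc (M n) '' A (n + 1) = trunc (M n) '' A n) :
    ∃ L : Set (ℕ → Bool), IsClosed L ∧ ∀ n, trunc (M n) '' L = trunc (M n) '' A n := by
  have hA' : ∀ n j, trunc (M n) '' A (n + j) = trunc (M n) '' A n := by
    intro n j
    induction j with
    | zero => rfl
    | succ j ih => exact (trunc_image_eq_of_le (hM (Nat.le_add_right n j)) (hA (n + j))).trans ih
  have hclosed : ∀ n, IsClosed (trunc (M n) ⁻¹' (trunc (M n) '' A n)) := fun n =>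
    (isClopen_preimage_trunc _).isClosed
  have hanti : Antitone fun n => trunc (M n) ⁻¹' (trunc (M n) '' A n) :=
    antitone_nat_of_succ_le fun n x hx => by
      obtain ⟨y, hy, hyx⟩ := hx
      rw [mem_preimage, ← hA n]
      exact ⟨y, hy, trunc_eq_trunc_iff.2 fun i hi =>
        trunc_eq_trunc_iff.1 hyx i (hi.trans_le (hM n.le_succ))⟩
  refine ⟨⋂ n, trunc (M n) ⁻¹' (trunc (M n) '' A n), isClosed_iInter hclosed, fun n => ?_⟩
  refine Subset.antisymm (image_subset_iff.2 (iInter_subset _ n)) ?_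
  rintro _ ⟨y, hy, rfl⟩
  obtain ⟨x, hx⟩ := IsCompact.nonempty_iInter_of_sequence_nonempty_isCompact_isClosed
    (fun j => trunc (M n) ⁻¹' {trunc (M n) y} ∩ trunc (M (n + j)) ⁻¹' (trunc (M (n + j)) '' A (n + j)))
    (fun j => inter_subset_inter_right _ (hanti (Nat.le_succ (n + j))))
    (fun j => by
      obtain ⟨z, hz, hzy⟩ := (hA' n j).ge ⟨y, hy, rfl⟩
      exact ⟨z, hzy, z, hz, rfl⟩)
    (((isClopen_preimage_trunc _).isClosed.inter (hclosed _)).isCompact)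
    (fun j => (isClopen_preimage_trunc _).isClosed.inter (hclosed _))
  rw [mem_iInter] at hx
  exact ⟨x, mem_iInter.2 fun j => hanti (Nat.le_add_left j n) (hx j).2, (hx 0).1⟩

-- Compact sets `K n ∈ S` are chosen to enter the dense open sets one by one, each keeping the trace
-- of its predecessor up to a growing precision. The complement of `X` is covered by the points
-- separated from `K n` at level `k`; a reply `k` raises the precision to at least `k`. In a play
-- that covers `Xᶜ`, the limit of the `K n` avoids `Xᶜ`.
open NonemptyCompacts in
theorem isHereditarilyBaire_nonemptyCompacts {X : Set (ℕ → Bool)} (hX : IsMengerSpace ↥Xᶜ) :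
    IsHereditarilyBaire (NonemptyCompacts X) := by
  intro S hS
  have hbasis : ∀ O : Set S, IsOpen O → ∀ K ∈ O, ∃ n, ∀ L : S,
      trunc n '' L.1.ambient = trunc n '' K.1.ambient → L ∈ O := by
    intro O hO K hK
    obtain ⟨W, hW, rfl⟩ := isOpen_induced_iff.1 hO
    obtain ⟨n, hn⟩ := exists_trunc_of_mem_isOpen hW hK
    exact ⟨n, fun L hL => hn L hL⟩
  refine ⟨fun f hfo hfd => dense_iff_inter_open.2 fun V hV ⟨K₀, hK₀⟩ => ?_⟩
  obtain ⟨m₀, hm₀⟩ := hbasis V hV K₀ hK₀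
  have hstep : ∀ n (K : S) (m : ℕ), ∃ p : S × ℕ, trunc m '' p.1.1.ambient = trunc m '' K.1.ambient ∧
      m ≤ p.2 ∧ n ≤ p.2 ∧
      ∀ L : S, trunc p.2 '' L.1.ambient = trunc p.2 '' p.1.1.ambient → L ∈ f n := by
    intro n K m
    have ho : IsOpen {L : S | trunc m '' L.1.ambient = trunc m '' K.1.ambient} :=
      (isClopen_setOf_trunc_image_ambient m _).isOpen.preimage continuous_subtype_val
    obtain ⟨K', hK', hK'f⟩ := dense_iff_inter_open.1 (hfd n) _ ho ⟨K, rfl⟩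
    obtain ⟨l, hl⟩ := hbasis (f n) (hfo n) K' hK'f
    exact ⟨⟨K', max l (max m n)⟩, hK', by simp, by simp,
      fun L hL => hl L (trunc_image_eq_of_le (le_max_left _ _) hL)⟩
  choose next hnext_trunc hnext_le hnext_ge hnext_mem using hstep
  -- A position records the round, which selects the dense set `f n`, the current compact set and
  -- its precision.
  obtain ⟨s, g, hs0, hs, hg⟩ := hX.exists_play (σ := ℕ × S × ℕ) (0, K₀, m₀)
    (fun p k => (p.1 + 1, next p.1 p.2.1 (max p.2.2 k)))
    (fun p k => {x | trunc k x ∉ trunc k '' p.2.1.1.ambient})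
    (fun p k => (isClopen_preimage_trunc (trunc k '' p.2.1.1.ambient)ᶜ).isOpen.preimage
      continuous_subtype_val)
    (fun p k l hkl x hx hxl => hx (by
      obtain ⟨y, hy, hyx⟩ := hxl
      exact ⟨y, hy, trunc_eq_trunc_iff.2 fun i hi =>
        trunc_eq_trunc_iff.1 hyx i (hi.trans_le hkl)⟩))
    (fun p x => by
      obtain ⟨k, hk⟩ := exists_trunc_of_isOpen p.2.1.1.isCompact_ambient.isClosed.isOpen_compl
        (x := x.1) (fun hx => x.2 (p.2.1.1.ambient_subset hx))
      exact ⟨k, fun ⟨y, hy, hyx⟩ => hk y hyx hy⟩)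
  have hs1 : ∀ n, (s n).1 = n := by
    intro n
    induction n with
    | zero => rw [hs0]
    | succ n ih => rw [hs, ih]
  let K : ℕ → S := fun n => (s n).2.1
  let M : ℕ → ℕ := fun n => max (s n).2.2 (g n)
  have hsucc : ∀ n, (s (n + 1)).2 = next n (K n) (M n) := fun n => by
    rw [hs]
    simp only [hs1, K, M]
  have hMle : ∀ n, M n ≤ (s (n + 1)).2.2 := fun n => by
    rw [hsucc]
    exact hnext_le _ _ _
  have hM : Monotone M := monotone_nat_of_le_succ fun n => (hMle n).trans (le_max_left _ _)
  have hMn : ∀ n, n ≤ M (n + 1) := fun n => by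
    refine le_trans ?_ (le_max_left _ _)
    rw [hsucc]
    exact hnext_ge _ _ _
  obtain ⟨A, hA, hAK⟩ := exists_isClosed_trunc_image_eq (fun n => (K n).1.ambient) hM fun n => by
    simp only [K, hsucc]
    exact hnext_trunc _ _ _
  have hAX : A ⊆ X := fun x hx => by
    by_contra hxX
    obtain ⟨n, hn⟩ := hg ⟨x, hxX⟩
    exact hn ((trunc_image_eq_of_le (le_max_right _ _) (hAK n)).le ⟨x, hx, rfl⟩)
  have hAne : A.Nonempty := by
    rw [← image_nonempty (f := trunc (M 0)), hAK 0, image_nonempty]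
    exact (K 0).1.nonempty.image _
  obtain ⟨L, rfl⟩ := exists_ambient_eq hA.isCompact hAne hAX
  have hLS : L ∈ S := by
    by_contra hLS
    obtain ⟨n, hn⟩ := exists_trunc_of_mem_isOpen hS.isOpen_compl hLS
    exact hn (K (n + 1)) (trunc_image_eq_of_le (hMn n) (hAK (n + 1)).symm) (K (n + 1)).2
  refine ⟨⟨L, hLS⟩, hm₀ _ ?_, mem_iInter.2 fun n => ?_⟩
  · have h0 : m₀ ≤ M 0 := by
      simp only [M, hs0]
      exact le_max_left _ _
    have hK0 : K 0 = K₀ := by simp only [K, hs0]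
    exact hK0 ▸ trunc_image_eq_of_le h0 (hAK 0)
  · have hmem := hnext_mem n (K n) (M n)
    rw [← hsucc] at hmem
    exact hmem _ (trunc_image_eq_of_le (le_max_left _ _) (hAK (n + 1)))

/-! ### From hereditarily Baire hyperspaces to strong `P`-filters. -/

/-- The number of the block containing `i` when `ℕ` is cut after each `j` with `e j = true`. -/
def blockIndex (e : ℕ → Bool) (i : ℕ) : ℕ := Nat.count (fun j => e j = true) i

/-- All ways to glue the blocks determined by `e`, the block numbered `n` being taken from an
element of `C n`. -/
def gluings (C : ℕ → Set (ℕ → Bool)) (e : ℕ → Bool) : Set (ℕ → Bool) :=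
  (fun (X : ℕ → ℕ → Bool) i => X (blockIndex e i) i) '' univ.pi C

theorem isCompact_gluings {C : ℕ → Set (ℕ → Bool)} (hC : ∀ n, IsCompact (C n)) (e : ℕ → Bool) :
    IsCompact (gluings C e) :=
  (isCompact_univ_pi hC).image (by fun_prop)

theorem gluings_nonempty {C : ℕ → Set (ℕ → Bool)} (hC : ∀ n, (C n).Nonempty) (e : ℕ → Bool) :
    (gluings C e).Nonempty :=
  (univ_pi_nonempty_iff.2 hC).image _

theorem blockIndex_congr {e e' : ℕ → Bool} {i : ℕ} (h : ∀ j < i, e j = e' j) :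
    blockIndex e i = blockIndex e' i := by
  induction i with
  | zero => rfl
  | succ i ih =>
    have := ih fun j hj => h j (hj.trans i.lt_succ_self)
    simp only [blockIndex, Nat.count_succ, h i i.lt_succ_self] at this ⊢
    rw [this]

/-- This is Vietoris continuity in the cut set `e`. -/
theorem trunc_image_gluings_congr (C : ℕ → Set (ℕ → Bool)) {e e' : ℕ → Bool} {n : ℕ}
    (h : ∀ i < n, e i = e' i) : trunc n '' gluings C e = trunc n '' gluings C e' := by
  simp only [gluings, image_image]
  refine image_congr fun X _ => trunc_eq_trunc_iff.2 fun i hi => ?_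
  rw [blockIndex_congr fun j hj => h j (hj.trans hi)]

/-- After the last cut a glued set follows a single member of some `C n`, hence agrees with it on a
cofinite set. -/
theorem gluings_subset_of_eventually_false {F : Filter ℕ} (hfree : F ≤ Filter.cofinite)
    {C : ℕ → Set (ℕ → Bool)} (hC : ∀ n, C n ⊆ cantorSubset F.sets) {e : ℕ → Bool} {N : ℕ}
    (he : ∀ i, N ≤ i → e i = false) : gluings C e ⊆ cantorSubset F.sets := by
  rintro _ ⟨X, hX, rfl⟩
  have hconst : ∀ i, N ≤ i → blockIndex e i = blockIndex e N := by
    intro i hi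
    induction i, hi using Nat.le_induction with
    | base => rfl
    | succ i hi ih =>
      rw [← ih]
      simp [blockIndex, Nat.count_succ, he i hi]
  have hN : {i | N ≤ i} ∈ F := hfree (by
    rw [Nat.cofinite_eq_atTop]
    exact Filter.eventually_ge_atTop N)
  refine Filter.mem_of_superset
    (Filter.inter_mem (hC (blockIndex e N) (hX _ (mem_univ _))) hN) fun i hi => ?_
  have h1 : X (blockIndex e N) i = true := hi.1
  change X (blockIndex e i) i = true
  rwa [hconst i hi.2]

theorem exists_strictMono_of_gluings_subset {F : Filter ℕ} {C : ℕ → Set (ℕ → Bool)} {e : ℕ → Bool}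
    (he : {i | e i = true}.Infinite) (hsub : gluings C e ⊆ cantorSubset F.sets) :
    ∃ k : ℕ → ℕ, k 0 = 0 ∧ StrictMono k ∧ ∀ X : ℕ → (ℕ → Bool), (∀ n, X n ∈ C n) →
      (⋃ n, cantorSupport (X n) ∩ Ico (k n) (k (n + 1))) ∈ F := by
  let k : ℕ → ℕ := fun n => n.casesOn 0 fun n => Nat.nth (fun i => e i = true) n + 1
  have hk : ∀ n i, i < k (n + 1) ↔ blockIndex e i ≤ n := fun n i => by
    rw [blockIndex, Nat.count_le_iff_le_nth he]
    exact Nat.lt_succ_iff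
  have hkm : StrictMono k := strictMono_nat_of_lt_succ fun n => by
    rcases n with _ | n
    · exact Nat.succ_pos _
    · exact Nat.succ_lt_succ (Nat.nth_strictMono he n.lt_succ_self)
  refine ⟨k, rfl, hkm, fun X hX => Filter.mem_of_superset
    (hsub ⟨X, fun n _ => hX n, rfl⟩) fun i hi => mem_iUnion.2 ⟨blockIndex e i, hi, ?_, ?_⟩⟩
  · rcases h : blockIndex e i with _ | n
    · exact Nat.zero_le _
    · rw [← not_lt, hk]
      omega
  · rw [hk]

open NonemptyCompacts in
theorem isStrongPFilter_of_isHereditarilyBaire {F : Filter ℕ} (hfree : F ≤ Filter.cofinite)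
    (hB : IsHereditarilyBaire (NonemptyCompacts ↥(cantorSubset F.sets))) : IsStrongPFilter F := by
  classical
  intro C hC
  by_cases hne : ∀ n, (C n).Nonempty
  swap
  · obtain ⟨n, hn⟩ := not_forall.1 hne
    exact ⟨id, rfl, strictMono_id, fun X hX => absurd ⟨X n, hX n⟩ hn⟩
  suffices h : ∃ e : ℕ → Bool, {i | e i = true}.Infinite ∧
      gluings C e ⊆ cantorSubset F.sets by
    obtain ⟨e, he, hsub⟩ := h
    exact exists_strictMono_of_gluings_subset he hsub
  by_contra! hno
  let χ : Finset ℕ → ℕ → Bool := fun J i => decide (i ∈ J)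
  have hχ : ∀ J : Finset ℕ, gluings C (χ J) ⊆ cantorSubset F.sets := fun J =>
    gluings_subset_of_eventually_false hfree (fun n => (hC n).2) (N := J.sup id + 1) fun i hi =>
      decide_eq_false fun hiJ => by
        have := Finset.le_sup (f := id) hiJ
        simp only [id] at this
        omega
  choose K hK using fun J => exists_ambient_eq (isCompact_gluings (fun n => (hC n).1) (χ J))
    (gluings_nonempty hne (χ J)) (hχ J)
  have hclosed : IsClosed (range K) := by
    refine isClosed_of_closure_subset fun L hL => ?_
    have happrox : ∀ n, ∃ J, trunc n '' L.ambient = trunc n '' gluings C (χ J) := fun n => by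
      obtain ⟨_, hn, J, rfl⟩ := mem_closure_iff.1 hL _
        (isClopen_setOf_trunc_image_ambient n (trunc n '' L.ambient)).isOpen rfl
      exact ⟨J, hK J ▸ hn.symm⟩
    choose J hJ using happrox
    -- A cluster point of the cut sets realises the limit `L`; since `L` lies in `F`, `hno` makes
    -- this cut set finite.
    obtain ⟨e, he⟩ : ∃ e : ℕ → Bool, ∀ n, trunc n '' L.ambient = trunc n '' gluings C e := by
      obtain ⟨e, -, he⟩ := isCompact_univ.exists_mapClusterPt
        (f := Filter.atTop) (u := fun n => χ (J n)) (by simp)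
      refine ⟨e, fun n => ?_⟩
      have hnhds : trunc n ⁻¹' {trunc n e} ∈ nhds e :=
        (isClopen_preimage_trunc _).isOpen.mem_nhds rfl
      obtain ⟨m, hm, hmn⟩ := ((he.frequently hnhds).and_eventually
        (Filter.eventually_ge_atTop n)).exists
      rw [trunc_image_eq_of_le hmn (hJ m)]
      exact trunc_image_gluings_congr C (trunc_eq_trunc_iff.1 hm)
    have hLe : L.ambient = gluings C e :=
      eq_of_trunc_image_eq L.isCompact_ambient.isClosed
        (isCompact_gluings (fun n => (hC n).1) e).isClosed he
    have hfin : {i | e i = true}.Finite := by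
      by_contra hinf
      exact hno e hinf (hLe ▸ L.ambient_subset)
    refine ⟨hfin.toFinset, ambient_injective ?_⟩
    rw [hK, hLe]
    congr 1
    ext i
    simp [χ]
  have := hB _ hclosed
  have : Nonempty (range K) := ⟨⟨K ∅, ∅, rfl⟩⟩
  obtain ⟨J, L, hL⟩ := nonempty_interior_of_iUnion_of_closed
    (f := fun J : Finset ℕ => ({⟨K J, J, rfl⟩} : Set (range K))) (fun J => isClosed_singleton)
    (eq_univ_of_forall fun ⟨_, J, hJ⟩ => mem_iUnion.2 ⟨J, Subtype.ext hJ.symm⟩)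
  obtain rfl : L = ⟨K J, J, rfl⟩ :=
    mem_singleton_iff.1 (interior_subset hL)
  obtain ⟨W, hW, hWJ⟩ := isOpen_induced_iff.1
    (isOpen_interior (s := ({⟨K J, J, rfl⟩} : Set (range K))))
  obtain ⟨n, hn⟩ := exists_trunc_of_mem_isOpen hW (hWJ.ge hL)
  have hiso : ∀ I, (∀ i < n, χ I i = χ J i) → gluings C (χ I) = gluings C (χ J) := by
    intro I hI
    have hIW : K I ∈ W := hn (K I) (by
      rw [hK, hK]
      exact trunc_image_gluings_congr C hI)
    have h1 : (⟨K I, I, rfl⟩ : range K) = ⟨K J, J, rfl⟩ :=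
      mem_singleton_iff.1 (interior_subset (hWJ.le hIW))
    have h2 : K I = K J := congrArg Subtype.val h1
    rw [← hK, ← hK, h2]
  -- The point `K J` is isolated, so adding finitely many cuts beyond `n` leaves the gluings
  -- unchanged; in the limit, so does adding all of them, which contradicts `hno`.
  let e : ℕ → Bool := fun i => decide (i ∈ J ∨ n ≤ i)
  refine hno e ((Set.Ici_infinite n).mono fun i hi => decide_eq_true (Or.inr hi)) ?_
  have he : gluings C e = gluings C (χ J) := by
    refine eq_of_trunc_image_eq (isCompact_gluings (fun n => (hC n).1) e).isClosed
      (isCompact_gluings (fun n => (hC n).1) (χ J)).isClosed fun m => ?_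
    let I : Finset ℕ := J ∪ (Finset.range m).filter fun i => n ≤ i
    rw [← hiso I fun i hi => by simp [χ, I, hi.not_ge]]
    exact trunc_image_gluings_congr C fun i hi => by simp [e, χ, I, hi]
  exact he ▸ hχ J

/-! ### Complementation and the equivalences. -/

/-- The complement of a filter, as a subspace of the Cantor set, is homeomorphic to the family of
positive sets via complementation. -/
def complHomeomorph (F : Filter ℕ) :
    ↥(cantorSubset (positiveSets F)) ≃ₜ ↥(cantorSubset F.sets)ᶜ where
  toFun x := ⟨fun i => !x.1 i, by
    have := x.2
    rw [mem_cantorSubset_positiveSets, ← cantorSupport_not] at this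
    exact this⟩
  invFun x := ⟨fun i => !x.1 i, by
    rw [mem_cantorSubset_positiveSets, cantorSupport_not, compl_compl]
    exact x.2⟩
  left_inv x := by simp
  right_inv x := by simp
  continuous_toFun := (continuous_not_comp.comp continuous_subtype_val).subtype_mk _
  continuous_invFun := (continuous_not_comp.comp continuous_subtype_val).subtype_mk _

theorem Homeomorph.isMengerSpace_iff {X Y : Type*} [TopologicalSpace X] [TopologicalSpace Y]
    (h : X ≃ₜ Y) : IsMengerSpace X ↔ IsMengerSpace Y :=
  ⟨fun hX => hX.of_surjective h.continuous h.surjective,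
    fun hY => hY.of_surjective h.symm.continuous h.symm.surjective⟩

theorem dense_cantorSubset {F : Filter ℕ} (hfree : F ≤ Filter.cofinite) :
    Dense (cantorSubset F.sets) := by
  refine dense_iff_inter_open.2 fun U hU ⟨x, hx⟩ => ?_
  obtain ⟨n, hn⟩ := exists_trunc_of_isOpen hU hx
  refine ⟨fun i => x i || decide (n ≤ i), hn _ (trunc_eq_trunc_iff.2 fun i hi => ?_), ?_⟩
  · simp [hi.not_ge]
  · have hnF : {i | n ≤ i} ∈ F := hfree (by
      rw [Nat.cofinite_eq_atTop]
      exact Filter.eventually_ge_atTop n)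
    refine Filter.mem_of_superset hnF fun i (hi : n ≤ i) => ?_
    simp [cantorSupport, hi]

theorem isCompactification_subtype_val {F : Filter ℕ} (hfree : F ≤ Filter.cofinite) :
    IsCompactification (Subtype.val : ↥(cantorSubset F.sets) → ℕ → Bool) where
  compactSpace := inferInstance
  t2Space := inferInstance
  isDenseEmbedding := (dense_cantorSubset hfree).isDenseEmbedding_val

theorem theorem4p3 (F : Filter ℕ) (hproper : F.NeBot) (hfree : F ≤ Filter.cofinite) :
    List.TFAE [
      IsStrongPFilter F,
      IsMengerAtInfinity ↥(cantorSubset F.sets),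
      HasAllRemaindersMenger ↥(cantorSubset F.sets),
      IsHereditarilyBaire (NonemptyCompacts ↥(cantorSubset F.sets)),
      IsMengerSpace ↥(cantorSubset (positiveSets F))] := by
  have hval := isCompactification_subtype_val hfree
  have hrange : (range (Subtype.val : ↥(cantorSubset F.sets) → ℕ → Bool))ᶜ =
      (cantorSubset F.sets)ᶜ := by rw [Subtype.range_val]
  have hiff : IsMengerSpace ↥(cantorSubset (positiveSets F)) ↔
      IsMengerSpace ↥(range (Subtype.val : ↥(cantorSubset F.sets) → ℕ → Bool))ᶜ := by
    rw [hrange]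
    exact (complHomeomorph F).isMengerSpace_iff
  tfae_have 1 → 5 := IsStrongPFilter.isMengerSpace
  tfae_have 5 → 4 := fun h =>
    isHereditarilyBaire_nonemptyCompacts ((complHomeomorph F).isMengerSpace_iff.1 h)
  tfae_have 4 → 1 := isStrongPFilter_of_isHereditarilyBaire hfree
  tfae_have 5 → 3 := fun h Z _ e he => hval.isMengerSpace_remainder he (hiff.1 h)
  tfae_have 3 → 2 := fun h => ⟨ℕ → Bool, inferInstance, Subtype.val, hval, h _ _ hval⟩
  tfae_have 2 → 5 := fun ⟨Z, _, e, he, hZ⟩ => hiff.2 (he.isMengerSpace_remainder hval hZ)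
  tfae_finish
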